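/- Let $d\ge 1$ be an integer and $\alpha>\frac d2$. For $a>0$ and $\beta,\gamma>\alpha$, the Gauss hypergeometric covariance on $\mathbb{R}^d$ is $$G_d(\boldsymbol h;a,\alpha,\beta,\gamma)=\frac{\Gamma(\beta-\frac d2)\,\Gamma(\gamma-\frac d2)}{\Gamma(\beta-\alpha+\gamma-\frac d2)\,\Gamma(\alpha-\frac d2)}\Bigl(1-\frac{\|\boldsymbol h\|^2}{a^2}\Bigr)_+^{\beta-\alpha+\gamma-\frac d2-1}{}_2F_1\Bigl(\beta-\alpha,\gamma-\alpha;\beta-\alpha+\gamma-\tfrac d2;\bigl(1-\tfrac{\|\boldsymbol h\|^2}{a^2}\bigr)_+\Bigr),\quad \boldsymbol h\in\mathbb{R}^d,$$ where $\|\cdot\|$ is the Euclidean norm, $x_+=\max(x,0)$ and ${}_2F_1$ is the Gauss hypergeometric function. Then, as $a$, $\beta$ and $\gamma$ tend to $+\infty$ (with $d$ and $\alpha$ fixed) in such a way that $\frac{a}{2\sqrt{\beta\gamma}}$ tends to a constant $b>0$, $G_d(\cdot;a,\alpha,\beta,\gamma)$ converges uniformly on $\mathbb{R}^d$ to the Matérn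 covariance with scale factor $b$ and smoothness parameter $\alpha-\frac d2$, $$\boldsymbol h\mapsto\frac{2}{\Gamma(\alpha-\frac d2)}\Bigl(\frac{\|\boldsymbol h\|}{2b}\Bigr)^{\alpha-\frac d2}K_{\alpha-\frac d2}\Bigl(\frac{\|\boldsymbol h\|}{b}\Bigr),\quad \boldsymbol h\in\mathbb{R}^d,$$ extended by continuity by the value $1$ at $\boldsymbol h=\boldsymbol 0$, where $K_\nu$ is the modified Bessel function of the second kind of order $\nu$. -/

import Mathlib

noncomputable section

/-- The Gauss hypergeometric covariance
`G_d(h; a, α, β, γ) = Γ(β - d/2) Γ(γ - d/2) / (Γ(β - α + γ - d/2) Γ(α - d/2))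
  * (1 - ‖h‖²/a²)₊ ^ (β - α + γ - d/2 - 1)
  * ₂F₁(β - α, γ - α; β - α + γ - d/2; (1 - ‖h‖²/a²)₊)` on the Euclidean space `ℝ^d`.
Mathlib's `ordinaryHypergeometric` is the sum of the hypergeometric power series, also at the
boundary point `1` (reached at `h = 0`), where that series converges for `α > d/2` once `β` and
`γ` are larger than `α`. -/
def gaussHypergeometricCov (d : ℕ) (a α β γ : ℝ) (h : EuclideanSpace ℝ (Fin d)) : ℝ :=
  Real.Gamma (β - d / 2) * Real.Gamma (γ - d / 2) /
      (Real.Gamma (β - α + γ - d / 2) * Real.Gamma (α - d / 2)) *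
    (max (1 - ‖h‖ ^ 2 / a ^ 2) 0) ^ (β - α + γ - d / 2 - 1) *
    ordinaryHypergeometric (β - α) (γ - α) (β - α + γ - d / 2) (max (1 - ‖h‖ ^ 2 / a ^ 2) 0)

/-- The modified Bessel function of the second kind `K_ν(x)`, for real order `ν` and `x > 0`
(the integral converges exactly for these `x`). -/
def besselK (ν x : ℝ) : ℝ :=
  ∫ t in Set.Ioi (0 : ℝ), Real.exp (-x * Real.cosh t) * Real.cosh (ν * t)

/-- The Matérn covariance on `ℝ^d` with scale factor `b` and smoothness parameter `ν`,
`h ↦ 2 / Γ(ν) * (‖h‖ / (2b)) ^ ν * K_ν(‖h‖ / b)`. At `h = 0`, where `K_ν` is infinite, the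
expression stands for its continuous extension, whose value is `1`. -/
def maternCov (d : ℕ) (b ν : ℝ) (h : EuclideanSpace ℝ (Fin d)) : ℝ :=
  if h = 0 then 1
  else 2 / Real.Gamma ν * (‖h‖ / (2 * b)) ^ ν * besselK ν (‖h‖ / b)

end

section

open MeasureTheory Set Filter Topology

/-! Both covariances are weighted averages over `u > 0`. Put `ν = α - d/2`, `B = β - d/2`, `C = γ -
d/2`. Euler's integral for `₂F₁` and the substitution `u = C * (1 - x * t)`, `x = 1 - ‖h‖²/a²`, turn
`G_d` into the average of `(1 - C‖h‖²/(a²u))₊ ^ (B - 1)` with weight `u ^ (ν - 1) * (1 - u/C)₊ ^ (C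
- ν - 1)`. The Matérn covariance is the average of `exp (-‖h‖²/(4b²u))` with weight `u ^ (ν - 1) *
exp (-u)`.

The weights do not involve `h` and converge in `L¹` (`tendsto_integral_abs_gammaApprox_sub`). The
averaged functions differ by a bound independent of `h` and `u`: `abs_truncatedPower_sub_exp_neg_le`
replaces the power by an exponential, and `abs_exp_neg_mul_sub_exp_neg_le` absorbs the scale
mismatch `θ → 1`. `abs_average_sub_average_le` combines the two errors, so convergence is uniform.
-/

/-! ### Beta integrals and Euler's integral for `₂F₁`. -/

theorem integrableOn_rpow_mul_one_sub_rpow {u v : ℝ} (hu : 0 < u) (hv : 0 < v) :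
    IntegrableOn (fun t : ℝ => t ^ (u - 1) * (1 - t) ^ (v - 1)) (Ioo 0 1) := by
  have h := Complex.betaIntegral_convergent (u := u) (v := v) (by simpa) (by simpa)
  rw [intervalIntegrable_iff_integrableOn_Ioo_of_le zero_le_one] at h
  have h2 := h.re
  refine IntegrableOn.congr_fun h2 (fun t ht => ?_) measurableSet_Ioo
  have h1 : ((t : ℂ) ^ ((u : ℂ) - 1)) = ((t ^ (u - 1) : ℝ) : ℂ) := by
    rw [Complex.ofReal_cpow ht.1.le]; simp
  have h3 : ((1 - (t : ℂ)) ^ ((v : ℂ) - 1)) = (((1 - t) ^ (v - 1) : ℝ) : ℂ) := by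
    rw [Complex.ofReal_cpow (sub_nonneg.2 ht.2.le)]; simp
  simp only [h1, h3, ← Complex.ofReal_mul]
  exact Complex.ofReal_re _

theorem setIntegral_rpow_mul_one_sub_rpow {u v : ℝ} (hu : 0 < u) (hv : 0 < v) :
    ∫ t in Ioo (0 : ℝ) 1, t ^ (u - 1) * (1 - t) ^ (v - 1) =
      Real.Gamma u * Real.Gamma v / Real.Gamma (u + v) := by
  have h := ProbabilityTheory.beta_eq_betaIntegralReal u v hu hv
  rw [ProbabilityTheory.beta] at h
  rw [h, Complex.betaIntegral, intervalIntegral.integral_of_le zero_le_one,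
    ← integral_Ioc_eq_integral_Ioo, ← RCLike.re_eq_complex_re, ← integral_re]
  · rw [integral_Ioc_eq_integral_Ioo, integral_Ioc_eq_integral_Ioo]
    refine setIntegral_congr_fun measurableSet_Ioo (fun t ht => ?_)
    have h1 : ((t : ℂ) ^ ((u : ℂ) - 1)) = ((t ^ (u - 1) : ℝ) : ℂ) := by
      rw [Complex.ofReal_cpow ht.1.le]; simp
    have h3 : ((1 - (t : ℂ)) ^ ((v : ℂ) - 1)) = (((1 - t) ^ (v - 1) : ℝ) : ℂ) := by
      rw [Complex.ofReal_cpow (sub_nonneg.2 ht.2.le)]; simp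
    simp only [h1, h3, ← Complex.ofReal_mul]
    exact (Complex.ofReal_re _).symm
  · have := Complex.betaIntegral_convergent (u := u) (v := v) (by simpa) (by simpa)
    rwa [intervalIntegrable_iff_integrableOn_Ioc_of_le zero_le_one] at this

theorem gamma_add_nat {s : ℝ} (hs : 0 < s) (n : ℕ) :
    Real.Gamma (s + n) = (ascPochhammer ℝ n).eval s * Real.Gamma s := by
  induction n with
  | zero => simp
  | succ n ih =>
    rw [ascPochhammer_succ_eval, Nat.cast_succ, ← add_assoc, Real.Gamma_add_one (by positivity), ih]
    ring

theorem ringChoose_add_sub_one (a : ℝ) (n : ℕ) :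
    Ring.choose (a + n - 1) n = (n.factorial : ℝ)⁻¹ * (ascPochhammer ℝ n).eval a := by
  have h := Ring.factorial_nsmul_multichoose_eq_ascPochhammer a n
  rw [Polynomial.ascPochhammer_smeval_eq_eval, nsmul_eq_mul] at h
  rw [Ring.choose, ← h, inv_mul_cancel_left₀ (by positivity)]
  congr 1
  ring

theorem hasSum_one_sub_rpow_neg (a : ℝ) {z : ℝ} (hz0 : 0 ≤ z) (hz1 : z < 1) :
    HasSum (fun n : ℕ => (n.factorial : ℝ)⁻¹ * (ascPochhammer ℝ n).eval a * z ^ n)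
      ((1 - z) ^ (-a)) := by
  have h := (Real.one_div_one_sub_rpow_hasFPowerSeriesOnBall_zero a).hasSum (y := z)
    (by simp [abs_of_nonneg hz0, hz1, ← ofReal_norm])
  simp only [FormalMultilinearSeries.ofScalars_apply_eq, zero_add, smul_eq_mul,
    ringChoose_add_sub_one] at h
  rwa [one_div, ← Real.rpow_neg (by linarith)] at h

/-- Expand `(1 - x * t) ^ (-a)` in its binomial series and integrate termwise against the Beta
weight. The condition `a + b < c` allows the endpoint `x = 1`, which is the case `h = 0`. -/
theorem ordinaryHypergeometric_mul_beta_eq_integral {a b c x : ℝ} (ha : 0 < a) (hb : 0 < b)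
    (hbc : b < c) (habc : a + b < c) (hx0 : 0 ≤ x) (hx1 : x ≤ 1) :
    ordinaryHypergeometric a b c x * (Real.Gamma b * Real.Gamma (c - b) / Real.Gamma c) =
      ∫ t in Ioo (0 : ℝ) 1, t ^ (b - 1) * (1 - t) ^ (c - b - 1) * (1 - x * t) ^ (-a) := by
  have hc : 0 < c := hb.trans hbc
  set p : ℕ → ℝ := fun n => (n.factorial : ℝ)⁻¹ * (ascPochhammer ℝ n).eval a * x ^ n with hp
  have hp0 : ∀ n, 0 ≤ p n := fun n => by
    have := ascPochhammer_pos n a ha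
    positivity
  set F : ℕ → ℝ → ℝ := fun n t => p n * (t ^ (b + n - 1) * (1 - t) ^ (c - b - 1)) with hF
  set f : ℝ → ℝ := fun t => t ^ (b - 1) * (1 - t) ^ (c - b - 1) * (1 - x * t) ^ (-a) with hf
  have hF0 : ∀ n, ∀ t ∈ Ioo (0 : ℝ) 1, 0 ≤ F n t := fun n t ht =>
    mul_nonneg (hp0 n) (mul_nonneg (Real.rpow_nonneg ht.1.le _)
      (Real.rpow_nonneg (sub_nonneg.2 ht.2.le) _))
  have hsum : ∀ t ∈ Ioo (0 : ℝ) 1, HasSum (fun n => F n t) (f t) := fun t ht => by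
    have h := (hasSum_one_sub_rpow_neg a (z := x * t) (mul_nonneg hx0 ht.1.le)
      (by nlinarith [ht.1, ht.2])).mul_left (t ^ (b - 1) * (1 - t) ^ (c - b - 1))
    convert! h using 1
    funext n
    simp only [hF, hp]
    rw [show b + n - 1 = b - 1 + n by ring, Real.rpow_add_natCast ht.1.ne', mul_pow]
    ring
  have hFint : ∀ n, IntegrableOn (F n) (Ioo 0 1) := fun n =>
    (integrableOn_rpow_mul_one_sub_rpow (u := b + n) (v := c - b) (by positivity)
      (by linarith)).const_mul _
  have hfm : AEStronglyMeasurable f (volume.restrict (Ioo 0 1)) := by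
    apply Measurable.aestronglyMeasurable
    simp only [hf]
    fun_prop
  have hfint : IntegrableOn f (Ioo 0 1) := by
    -- Since `1 - x * t ≥ 1 - t`, the worst case is `x = 1`, a Beta integrand with second parameter
    -- `c - b - a > 0`.
    refine Integrable.mono' (integrableOn_rpow_mul_one_sub_rpow (u := b) (v := c - b - a) hb
      (by linarith)) hfm ?_
    refine (ae_restrict_iff' measurableSet_Ioo).2 (Filter.Eventually.of_forall fun t ht => ?_)
    have h1 : 0 < 1 - t := sub_pos.2 ht.2
    have h2 : 1 - t ≤ 1 - x * t := by nlinarith [ht.1]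
    have h4 : 0 < 1 - x * t := h1.trans_le h2
    have h3 : (1 - x * t) ^ (-a) ≤ (1 - t) ^ (-a) :=
      Real.rpow_le_rpow_of_nonpos h1 h2 (by linarith)
    have h5 : 0 < t := ht.1
    rw [Real.norm_of_nonneg (by positivity)]
    calc f t ≤ t ^ (b - 1) * (1 - t) ^ (c - b - 1) * (1 - t) ^ (-a) := by
          simp only [hf]; gcongr
      _ = _ := by
          rw [mul_assoc, ← Real.rpow_add h1]
          congr 2
          ring
  have key : HasSum (fun n => ∫ t in Ioo (0 : ℝ) 1, F n t) (∫ t in Ioo (0 : ℝ) 1, f t) := by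
    -- The terms are nonnegative, so they serve as their own majorants, with integrable sum `f`.
    refine hasSum_integral_of_dominated_convergence F (fun n => (hFint n).aestronglyMeasurable)
      (fun n => ?_) ?_ ?_ ?_
    · refine (ae_restrict_iff' measurableSet_Ioo).2 (Filter.Eventually.of_forall fun t ht => ?_)
      rw [Real.norm_of_nonneg (hF0 n t ht)]
    · exact (ae_restrict_iff' measurableSet_Ioo).2
        (Filter.Eventually.of_forall fun t ht => (hsum t ht).summable)
    · exact hfint.congr_fun (fun t ht => (hsum t ht).tsum_eq.symm) measurableSet_Ioo
    · exact (ae_restrict_iff' measurableSet_Ioo).2 (Filter.Eventually.of_forall hsum)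
  rw [← key.tsum_eq, ordinaryHypergeometric_eq_tsum, ← tsum_mul_right]
  refine tsum_congr fun n => ?_
  simp only [hF, smul_eq_mul]
  rw [integral_const_mul, setIntegral_rpow_mul_one_sub_rpow (by positivity) (by linarith),
    show b + n + (c - b) = c + n by ring, gamma_add_nat hb, gamma_add_nat hc]
  have h1 := ascPochhammer_pos n c hc
  have h2 := Real.Gamma_pos_of_pos hc
  simp only [hp]
  field_simp

/-! ### Scale mixture form of the Gauss hypergeometric covariance. -/

/-- The finite-`C` approximation `u ^ (ν - 1) * (1 - u / C)₊ ^ (C - ν - 1)` of the Gamma density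
`u ^ (ν - 1) * exp (-u)`. -/
noncomputable def gammaApprox (ν C u : ℝ) : ℝ := u ^ (ν - 1) * (max (1 - u / C) 0) ^ (C - ν - 1)

/-- The truncated power `(1 - s)₊ ^ (B - 1)`. -/
noncomputable def truncatedPower (B s : ℝ) : ℝ := (max (1 - s) 0) ^ (B - 1)

theorem truncatedPower_nonneg (B s : ℝ) : 0 ≤ truncatedPower B s :=
  Real.rpow_nonneg (le_max_right _ _) _

theorem truncatedPower_of_one_le {B s : ℝ} (hB : 1 < B) (hs : 1 ≤ s) : truncatedPower B s = 0 := by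
  rw [truncatedPower, max_eq_right (by linarith), Real.zero_rpow (by linarith)]

theorem gammaApprox_of_le {ν C u : ℝ} (hC0 : 0 < C) (hC : ν + 1 < C) (hu : C ≤ u) :
    gammaApprox ν C u = 0 := by
  have : 1 ≤ u / C := (one_le_div hC0).2 hu
  rw [gammaApprox, max_eq_right (by linarith), Real.zero_rpow (by linarith), mul_zero]

theorem setIntegral_comp_mul_one_sub_mul (f : ℝ → ℝ) {C x : ℝ} (hC : 0 < C) (hx : 0 < x) :
    (∫ t in Ioo (0 : ℝ) 1, f (C * (1 - x * t)) * (C * x)) = ∫ u in Ioo (C * (1 - x)) C, f u := by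
  have h := intervalIntegral.integral_comp_sub_mul (a := 0) (b := 1) f (c := C * x)
    (by positivity) C
  rw [intervalIntegral.integral_of_le zero_le_one,
    intervalIntegral.integral_of_le (by nlinarith), integral_Ioc_eq_integral_Ioo,
    integral_Ioc_eq_integral_Ioo, smul_eq_mul, mul_one, mul_zero, sub_zero] at h
  rw [integral_mul_const]
  have e : ∀ t, C * (1 - x * t) = C - C * x * t := fun t => by ring
  simp only [e, h]
  rw [show C * (1 - x) = C - C * x by ring]
  field_simp

/-- The weight vanishes for `u ≥ C` and the truncated power for `u ≤ C * (1 - x)`; on the remaining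
interval, substitute `u = C * (1 - x * t)`. -/
theorem integral_gammaApprox_mul_truncatedPower {ν B C x : ℝ} (hC0 : 0 < C) (hC : ν + 1 < C)
    (hB : 1 < B) (hx0 : 0 < x) (hx1 : x ≤ 1) :
    ∫ u in Ioi (0 : ℝ), gammaApprox ν C u * truncatedPower B (C * (1 - x) / u) =
      C ^ ν * x ^ (B + C - ν - 1) *
        ∫ t in Ioo (0 : ℝ) 1, t ^ (C - ν - 1) * (1 - t) ^ (B - 1) * (1 - x * t) ^ (-(B - ν)) := by
  have hCx : 0 ≤ C * (1 - x) := mul_nonneg hC0.le (by linarith)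
  rw [setIntegral_eq_of_subset_of_forall_sdiff_eq_zero measurableSet_Ioi
    (s := Ioo (C * (1 - x)) C) (fun u hu => hCx.trans_lt hu.1),
    ← setIntegral_comp_mul_one_sub_mul _ hC0 hx0, ← integral_const_mul]
  · refine setIntegral_congr_fun measurableSet_Ioo fun t ht => ?_
    have ht0 : 0 < t := ht.1
    have ht1 : 0 < 1 - t := sub_pos.2 ht.2
    have hw : 0 < 1 - x * t := by nlinarith
    set w := 1 - x * t with hwdef
    have e1 : max (1 - C * w / C) 0 = x * t := by
      rw [mul_div_cancel_left₀ _ hC0.ne', max_eq_left] <;> simp only [hwdef] <;> nlinarith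
    have e2 : max (1 - C * (1 - x) / (C * w)) 0 = x * (1 - t) / w := by
      rw [mul_div_mul_left _ _ hC0.ne']
      have : 1 - (1 - x) / w = x * (1 - t) / w := by
        rw [eq_div_iff hw.ne', sub_mul, div_mul_cancel₀ _ hw.ne']; simp only [hwdef]; ring
      rw [this, max_eq_left (by positivity)]
    simp only [gammaApprox, truncatedPower, e1, e2]
    rw [Real.mul_rpow hC0.le hw.le, Real.mul_rpow hx0.le ht0.le,
      Real.div_rpow (by positivity) hw.le, Real.mul_rpow hx0.le ht1.le]
    have c1 : C ^ ν = C ^ (ν - 1) * C := by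
      rw [← Real.rpow_add_one hC0.ne', sub_add_cancel]
    have c2 : x ^ (B + C - ν - 1) = x ^ (C - ν - 1) * x ^ (B - 1) * x := by
      rw [← Real.rpow_add hx0, ← Real.rpow_add_one hx0.ne']; ring_nf
    have c3 : w ^ (-(B - ν)) = w ^ (ν - 1) / w ^ (B - 1) := by
      rw [← Real.rpow_sub hw]; ring_nf
    rw [c1, c2, c3]
    ring
  · rintro u ⟨hu0, hu⟩
    have hu0 : 0 < u := hu0
    rcases le_or_gt C u with h | h
    · rw [gammaApprox_of_le hC0 hC h, zero_mul]
    · have : u ≤ C * (1 - x) := by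
        by_contra! h'
        exact hu ⟨h', h⟩
      rw [truncatedPower_of_one_le hB ((one_le_div hu0).2 this), mul_zero]

theorem integral_gammaApprox {ν C : ℝ} (hν : 0 < ν) (hC : ν + 1 < C) :
    ∫ u in Ioi (0 : ℝ), gammaApprox ν C u =
      C ^ ν * (Real.Gamma (C - ν) * Real.Gamma ν / Real.Gamma C) := by
  -- At `x = 1` the truncated power is `1`, so any `B > 1` would do.
  have h := integral_gammaApprox_mul_truncatedPower (ν := ν) (B := 2) (C := C) (x := 1)
    (by linarith) hC one_lt_two one_pos le_rfl
  have e : ∀ u, truncatedPower 2 (C * (1 - 1) / u) = 1 := fun u => by simp [truncatedPower]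
  simp only [e, mul_one, Real.one_rpow] at h
  rw [h]
  congr 1
  have h2 := setIntegral_rpow_mul_one_sub_rpow (u := C - ν) (v := ν) (by linarith) hν
  rw [sub_add_cancel] at h2
  rw [← h2]
  refine setIntegral_congr_fun measurableSet_Ioo fun t ht => ?_
  have ht1 : 0 < 1 - t := sub_pos.2 ht.2
  simp only [one_mul, mul_assoc]
  rw [← Real.rpow_add ht1]
  ring_nf

/-- The Gauss hypergeometric covariance as a scale mixture of truncated power functions. -/
theorem gaussHypergeometricCov_mul_integral_gammaApprox {d : ℕ} {a α β γ : ℝ}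
    (hα : (d : ℝ) / 2 < α) (hβ : 1 < β - d / 2) (hβα : α < β) (hγ : α - d / 2 + 1 < γ - d / 2)
    (h : EuclideanSpace ℝ (Fin d)) :
    gaussHypergeometricCov d a α β γ h *
        ∫ u in Ioi (0 : ℝ), gammaApprox (α - d / 2) (γ - d / 2) u =
      ∫ u in Ioi (0 : ℝ), gammaApprox (α - d / 2) (γ - d / 2) u *
        truncatedPower (β - d / 2) ((γ - d / 2) * (‖h‖ ^ 2 / a ^ 2) / u) := by
  obtain ⟨ν, hν⟩ : ∃ ν, ν = α - d / 2 := ⟨_, rfl⟩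
  obtain ⟨B, hB⟩ : ∃ B, B = β - d / 2 := ⟨_, rfl⟩
  obtain ⟨C, hC⟩ : ∃ C, C = γ - d / 2 := ⟨_, rfl⟩
  rw [gaussHypergeometricCov, show β - α + γ - d / 2 = B + C - ν by rw [hν, hB, hC]; ring,
    show β - α = B - ν by rw [hν, hB]; ring, show γ - α = C - ν by rw [hν, hC]; ring,
    ← hν, ← hB, ← hC]
  rw [← hν, ← hC] at hγ
  rw [← hB] at hβ
  have hν0 : 0 < ν := by linarith
  have hBν : ν < B := by linarith
  have hC0 : 0 < C := by linarith
  have hy : 0 ≤ ‖h‖ ^ 2 / a ^ 2 := by positivity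
  set y := ‖h‖ ^ 2 / a ^ 2
  rcases le_or_gt 1 y with hy1 | hy1
  -- Outside the ball of radius `a` both sides vanish: for each `u`, either `u ≥ C` or `C * y / u ≥
  -- 1`.
  · rw [max_eq_right (by linarith), Real.zero_rpow (by linarith), mul_zero, zero_mul, zero_mul]
    symm
    refine setIntegral_eq_zero_of_forall_eq_zero fun u hu => ?_
    have hu : 0 < u := hu
    rcases le_or_gt C u with h | h
    · rw [gammaApprox_of_le hC0 hγ h, zero_mul]
    · rw [truncatedPower_of_one_le hβ, mul_zero]
      rw [one_le_div hu]
      nlinarith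
  · obtain ⟨x, hx⟩ : ∃ x, x = 1 - y := ⟨_, rfl⟩
    have hx0 : 0 < x := by linarith
    have hmix := integral_gammaApprox_mul_truncatedPower (ν := ν) hC0 hγ hβ hx0 (by linarith)
    -- Of the two symmetric numerator parameters, `C - ν` plays the Beta role, so that `c - b = B`.
    have heuler := ordinaryHypergeometric_mul_beta_eq_integral (a := B - ν) (b := C - ν)
      (c := B + C - ν) (x := x) (by linarith) (by linarith) (by linarith) (by linarith) hx0.le
      (by linarith)
    rw [show B + C - ν - (C - ν) = B by ring] at heuler
    rw [← hx, max_eq_left hx0.le, show y = 1 - x by linarith, hmix, ← heuler,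
      integral_gammaApprox hν0 hγ]
    have := Real.Gamma_pos_of_pos hν0
    have := Real.Gamma_pos_of_pos hC0
    have : 0 < Real.Gamma (B + C - ν) := Real.Gamma_pos_of_pos (by linarith)
    field_simp

/-! ### Scale mixture form of the Matérn covariance. -/

theorem integrableOn_rpow_mul_exp_neg {ν : ℝ} (hν : 0 < ν) :
    IntegrableOn (fun u : ℝ => u ^ (ν - 1) * Real.exp (-u)) (Ioi 0) := by
  simpa only [mul_comm] using Real.GammaIntegral_convergent hν

theorem setIntegral_rpow_mul_exp_neg {ν : ℝ} (hν : 0 < ν) :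
    ∫ u in Ioi (0 : ℝ), u ^ (ν - 1) * Real.exp (-u) = Real.Gamma ν := by
  rw [Real.Gamma_eq_integral hν]
  simp only [mul_comm]

theorem integrableOn_rpow_mul_exp_neg_mul_exp_neg_div {ν κ : ℝ} (hν : 0 < ν) (hκ : 0 ≤ κ) :
    IntegrableOn (fun u : ℝ => u ^ (ν - 1) * Real.exp (-u) * Real.exp (-(κ / u))) (Ioi 0) := by
  refine Integrable.mono' (integrableOn_rpow_mul_exp_neg hν)
    (Measurable.aestronglyMeasurable (by fun_prop)) ?_
  refine (ae_restrict_iff' measurableSet_Ioi).2 (Filter.Eventually.of_forall fun u hu => ?_)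
  have hu : 0 < u := hu
  rw [Real.norm_of_nonneg (by positivity)]
  refine mul_le_of_le_one_right (by positivity) (Real.exp_le_one_iff.2 ?_)
  have : 0 ≤ κ / u := by positivity
  linarith

theorem integral_exp_neg_cosh_mul_cosh {ν z : ℝ}
    (hint : Integrable fun t : ℝ => Real.exp (-z * Real.cosh t) * Real.exp (ν * t)) :
    ∫ t : ℝ, Real.exp (-z * Real.cosh t) * Real.exp (ν * t) =
      2 * ∫ t in Ioi (0 : ℝ), Real.exp (-z * Real.cosh t) * Real.cosh (ν * t) := by
  have h1 := integral_comp_neg_Ioi (0 : ℝ)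
    (fun t : ℝ => Real.exp (-z * Real.cosh t) * Real.exp (ν * t))
  rw [neg_zero] at h1
  rw [← intervalIntegral.integral_Iic_add_Ioi (b := 0) hint.integrableOn hint.integrableOn, ← h1,
    ← integral_add hint.comp_neg.integrableOn hint.integrableOn, ← integral_const_mul]
  refine setIntegral_congr_fun measurableSet_Ioi fun t _ => ?_
  simp only [Real.cosh_neg, Real.cosh_eq (ν * t), mul_neg]
  ring

theorem image_mul_exp_univ {c : ℝ} (hc : 0 < c) :
    (fun t : ℝ => c * Real.exp t) '' univ = Ioi 0 := by
  ext u
  constructor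
  · rintro ⟨t, -, rfl⟩
    exact mul_pos hc (Real.exp_pos t)
  · intro hu
    have hu : 0 < u := hu
    refine ⟨Real.log (u / c), mem_univ _, ?_⟩
    simp only [Real.exp_log (div_pos hu hc)]
    field_simp

/-- Under `u = (z / 2) * exp t` one has `u + z² / (4u) = z * cosh t`. Folding the line at `0` then
replaces `exp (ν * t)` by `2 * cosh (ν * t)`. -/
theorem besselK_eq_integral {ν z : ℝ} (hν : 0 < ν) (hz : 0 < z) :
    (z / 2) ^ ν * besselK ν z =
      2⁻¹ * ∫ u in Ioi (0 : ℝ), u ^ (ν - 1) * Real.exp (-u) * Real.exp (-(z ^ 2 / 4 / u)) := by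
  have hz2 : 0 < z / 2 := by positivity
  have hderiv : ∀ t ∈ (univ : Set ℝ), HasDerivWithinAt (fun t : ℝ => z / 2 * Real.exp t)
      (z / 2 * Real.exp t) univ t := fun t _ =>
    ((Real.hasDerivAt_exp t).const_mul (z / 2)).hasDerivWithinAt
  have hinj : InjOn (fun t : ℝ => z / 2 * Real.exp t) univ := fun s _ t _ hst =>
    Real.exp_injective (mul_left_cancel₀ hz2.ne' hst)
  have hcongr : ∀ t : ℝ, |z / 2 * Real.exp t| • ((z / 2 * Real.exp t) ^ (ν - 1) *
      Real.exp (-(z / 2 * Real.exp t)) * Real.exp (-(z ^ 2 / 4 / (z / 2 * Real.exp t)))) =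
      (z / 2) ^ ν * (Real.exp (-z * Real.cosh t) * Real.exp (ν * t)) := fun t => by
    have hpos : 0 < z / 2 * Real.exp t := by positivity
    have e1 : z / 2 * Real.exp t * (z / 2 * Real.exp t) ^ (ν - 1) =
        (z / 2) ^ ν * Real.exp (ν * t) := by
      rw [mul_comm, ← Real.rpow_add_one hpos.ne', sub_add_cancel,
        Real.mul_rpow hz2.le (Real.exp_pos t).le, ← Real.exp_mul, mul_comm t]
    have e2 : Real.exp (-(z / 2 * Real.exp t)) * Real.exp (-(z ^ 2 / 4 / (z / 2 * Real.exp t))) =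
        Real.exp (-z * Real.cosh t) := by
      rw [← Real.exp_add, Real.cosh_eq, Real.exp_neg]
      congr 1
      have := Real.exp_pos t
      field_simp
      ring
    rw [abs_of_pos hpos, smul_eq_mul, mul_assoc ((z / 2 * Real.exp t) ^ (ν - 1)), e2, ← mul_assoc,
      e1]
    ring
  have hint := integrableOn_rpow_mul_exp_neg_mul_exp_neg_div (κ := z ^ 2 / 4) hν (by positivity)
  rw [← image_mul_exp_univ hz2, integrableOn_image_iff_integrableOn_abs_deriv_smul
    MeasurableSet.univ hderiv hinj] at hint
  rw [← image_mul_exp_univ hz2, integral_image_eq_integral_abs_deriv_smul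
    MeasurableSet.univ hderiv hinj]
  simp only [hcongr, integrableOn_univ, setIntegral_univ] at hint ⊢
  have hint' := hint.const_mul ((z / 2) ^ ν)⁻¹
  simp only [inv_mul_cancel_left₀ (Real.rpow_pos_of_pos hz2 ν).ne'] at hint'
  rw [integral_const_mul, integral_exp_neg_cosh_mul_cosh hint', besselK]
  ring

/-- The Matérn covariance as a scale mixture of Gaussian covariances. -/
theorem maternCov_eq_integral {d : ℕ} {b ν : ℝ} (hb : 0 < b) (hν : 0 < ν)
    (h : EuclideanSpace ℝ (Fin d)) :
    maternCov d b ν h = (∫ u in Ioi (0 : ℝ), u ^ (ν - 1) * Real.exp (-u) *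
      Real.exp (-(‖h‖ ^ 2 / (4 * b ^ 2) / u))) / Real.Gamma ν := by
  have hΓ := Real.Gamma_pos_of_pos hν
  rw [maternCov]
  split_ifs with h0
  · simp [h0, setIntegral_rpow_mul_exp_neg hν, hΓ.ne']
  · have hh : 0 < ‖h‖ := norm_pos_iff.2 h0
    have key := besselK_eq_integral hν (div_pos hh hb)
    rw [show ‖h‖ / b / 2 = ‖h‖ / (2 * b) by field_simp,
      show (‖h‖ / b) ^ 2 / 4 = ‖h‖ ^ 2 / (4 * b ^ 2) by field_simp] at key
    rw [mul_assoc, key, ← mul_assoc, div_mul_eq_mul_div, mul_inv_cancel₀ two_ne_zero,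
      one_div_mul_eq_div]

/-! ### Uniform comparison of the averaged functions. -/

/-- With `n = B - 1` and `s ≤ 1`, `exp (-s) * (1 - s²) ≤ 1 - s ≤ exp (-s)`. Raising to the power `n`
and applying Bernoulli bounds the gap by `exp (-n s) * n s²`, which is at most `2 / n` because `x² ≤
2 exp x` for `x ≥ 0`. -/
theorem abs_truncatedPower_sub_exp_neg_le {B s : ℝ} (hB : 2 ≤ B) (hs : 0 ≤ s) :
    |truncatedPower B s - Real.exp (-((B - 1) * s))| ≤ 2 / (B - 1) := by
  set n := B - 1 with hn
  have hn1 : 1 ≤ n := by linarith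
  have hn0 : 0 < n := by linarith
  have hns : 0 ≤ n * s := by positivity
  have hquad : Real.exp (-(n * s)) * (n * s) ^ 2 ≤ 2 := by
    have := Real.quadratic_le_exp_of_nonneg hns
    rw [Real.exp_neg, inv_mul_le_iff₀ (Real.exp_pos _)]
    nlinarith
  have hsq : Real.exp (-(n * s)) * (n * s ^ 2) ≤ 2 / n := by
    rw [le_div_iff₀ hn0]
    calc _ = Real.exp (-(n * s)) * (n * s) ^ 2 := by ring
      _ ≤ 2 := hquad
  have hup : truncatedPower B s ≤ Real.exp (-(n * s)) := by
    rw [truncatedPower, show -(n * s) = -s * n by ring, Real.exp_mul]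
    refine Real.rpow_le_rpow (le_max_right _ _) (max_le ?_ (Real.exp_pos _).le) (by linarith)
    linarith [Real.add_one_le_exp (-s)]
  rw [abs_sub_comm, abs_of_nonneg (sub_nonneg.2 hup)]
  refine le_trans ?_ hsq
  rcases le_or_gt s 1 with hs1 | hs1
  · have hbern : 1 - n * s ^ 2 ≤ (1 - s ^ 2) ^ n := by
      have := one_add_mul_self_le_rpow_one_add (s := -s ^ 2) (by nlinarith) hn1
      calc _ = 1 + n * (-s ^ 2) := by ring
        _ ≤ _ := by rwa [← sub_eq_add_neg] at this
    have hlow : Real.exp (-(n * s)) * (1 - s ^ 2) ^ n ≤ truncatedPower B s := by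
      rw [truncatedPower, max_eq_left (by linarith), show -(n * s) = -s * n by ring, Real.exp_mul,
        ← Real.mul_rpow (Real.exp_pos _).le (by nlinarith)]
      refine Real.rpow_le_rpow (mul_nonneg (Real.exp_pos _).le (by nlinarith)) ?_ hn0.le
      rw [Real.exp_neg, inv_mul_le_iff₀ (Real.exp_pos _)]
      nlinarith [Real.add_one_le_exp s]
    have := mul_le_mul_of_nonneg_left hbern (Real.exp_pos (-(n * s))).le
    linarith
  · rw [truncatedPower_of_one_le (by linarith) hs1.le, sub_zero]
    refine le_mul_of_one_le_right (Real.exp_pos _).le ?_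
    nlinarith

theorem abs_exp_neg_mul_sub_exp_neg_le {θ q : ℝ} (hθ : 0 < θ) (hq : 0 ≤ q) :
    |Real.exp (-(θ * q)) - Real.exp (-q)| ≤ |θ - 1| + |θ⁻¹ - 1| := by
  -- For `t ≥ 1` the gap is at most `(t - 1) * s * exp (-s) ≤ t - 1`. The case `θ ≤ 1` reduces to
  -- this with `t = θ⁻¹` and `s = θ * q`.
  have aux : ∀ {s t : ℝ}, 0 ≤ s → 1 ≤ t →
      |Real.exp (-(t * s)) - Real.exp (-s)| ≤ |t - 1| := fun {s t} hs ht => by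
    have h1 : Real.exp (-(t * s)) ≤ Real.exp (-s) := Real.exp_le_exp.2 (by nlinarith)
    have h2 : Real.exp (-(t * s)) = Real.exp (-s) * Real.exp (-((t - 1) * s)) := by
      rw [← Real.exp_add]; ring_nf
    have h3 := Real.one_sub_le_exp_neg ((t - 1) * s)
    have h4 : Real.exp (-s) * s ≤ 1 := by
      rw [Real.exp_neg, inv_mul_le_iff₀ (Real.exp_pos _)]
      linarith [Real.add_one_le_exp s]
    rw [abs_sub_comm, abs_of_nonneg (sub_nonneg.2 h1), abs_of_nonneg (sub_nonneg.2 ht), h2]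
    nlinarith [mul_le_mul_of_nonneg_left h3 (Real.exp_pos (-s)).le]
  rcases le_total 1 θ with h | h
  · exact (aux hq h).trans (le_add_of_nonneg_right (abs_nonneg _))
  · have := aux (s := θ * q) (by positivity) ((one_le_inv₀ hθ).2 h)
    rw [inv_mul_cancel_left₀ hθ.ne', abs_sub_comm] at this
    exact this.trans (le_add_of_nonneg_left (abs_nonneg _))

/-! ### `L¹` convergence of the weights. -/

/-- A majorant independent of `C`, for dominated convergence; the threshold on `C` says exactly that
`C - ν - 1 ≥ C / 2`. -/
theorem gammaApprox_le {ν C u : ℝ} (hν : 0 < ν) (hC : 2 * ν + 2 ≤ C) (hu : 0 ≤ u) :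
    gammaApprox ν C u ≤ u ^ (ν - 1) * Real.exp (-(u / 2)) := by
  have hC0 : 0 < C := by linarith
  refine mul_le_mul_of_nonneg_left ?_ (Real.rpow_nonneg hu _)
  calc (max (1 - u / C) 0) ^ (C - ν - 1) ≤ (Real.exp (-(u / C))) ^ (C - ν - 1) := by
        refine Real.rpow_le_rpow (le_max_right _ _) (max_le ?_ (Real.exp_pos _).le) (by linarith)
        linarith [Real.add_one_le_exp (-(u / C))]
    _ ≤ _ := by
        rw [← Real.exp_mul, Real.exp_le_exp]
        have : u / 2 = u / C * (C / 2) := by field_simp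
        rw [this, neg_mul, neg_le_neg_iff]
        exact mul_le_mul_of_nonneg_left (by linarith) (by positivity)

theorem gammaApprox_nonneg {ν C u : ℝ} (hu : 0 ≤ u) : 0 ≤ gammaApprox ν C u :=
  mul_nonneg (Real.rpow_nonneg hu _) (Real.rpow_nonneg (le_max_right _ _) _)

theorem measurable_gammaApprox (ν C : ℝ) : Measurable (gammaApprox ν C) := by
  unfold gammaApprox
  fun_prop

theorem integrableOn_rpow_mul_exp_neg_half {ν : ℝ} (hν : 0 < ν) :
    IntegrableOn (fun u : ℝ => u ^ (ν - 1) * Real.exp (-(u / 2))) (Ioi 0) := by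
  have := integrableOn_rpow_mul_exp_neg_mul_rpow (p := 1) (s := ν - 1) (b := 1 / 2)
    (by linarith) one_pos (by norm_num)
  simp only [Real.rpow_one] at this
  refine this.congr_fun (fun u _ => ?_) measurableSet_Ioi
  ring_nf

theorem integrableOn_gammaApprox {ν C : ℝ} (hν : 0 < ν) (hC : 2 * ν + 2 ≤ C) :
    IntegrableOn (gammaApprox ν C) (Ioi 0) := by
  refine Integrable.mono' (integrableOn_rpow_mul_exp_neg_half hν)
    (measurable_gammaApprox ν C).aestronglyMeasurable ?_
  refine (ae_restrict_iff' measurableSet_Ioi).2 (Eventually.of_forall fun u hu => ?_)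
  have hu : 0 < u := hu
  rw [Real.norm_of_nonneg (gammaApprox_nonneg hu.le)]
  exact gammaApprox_le hν hC hu.le

theorem tendsto_gammaApprox (ν u : ℝ) :
    Tendsto (fun C => gammaApprox ν C u) atTop (𝓝 (u ^ (ν - 1) * Real.exp (-u))) := by
  have h1 := Real.tendsto_one_add_div_rpow_exp (-u)
  have h2 : Tendsto (fun C : ℝ => 1 + -u / C) atTop (𝓝 1) := by
    simpa using (tendsto_const_nhds (x := -u)).div_atTop tendsto_id |>.const_add 1
  -- The fixed part `-(ν + 1)` of the exponent is split off and has no effect in the limit.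
  have h3 : Tendsto (fun C : ℝ => (1 + -u / C) ^ (-(ν + 1))) atTop (𝓝 1) := by
    simpa using h2.rpow_const (p := -(ν + 1)) (Or.inl one_ne_zero)
  have h4 := (h1.mul h3).const_mul (u ^ (ν - 1))
  rw [mul_one] at h4
  refine h4.congr' ?_
  filter_upwards [h2.eventually_const_lt one_pos] with C hC
  rw [gammaApprox, ← Real.rpow_add hC, ← sub_eq_add_neg, ← sub_sub,
    show 1 - u / C = 1 + -u / C by ring, max_eq_left hC.le]

theorem tendsto_integral_abs_gammaApprox_sub {ν : ℝ} (hν : 0 < ν) :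
    Tendsto (fun C => ∫ u in Ioi (0 : ℝ), |gammaApprox ν C u - u ^ (ν - 1) * Real.exp (-u)|)
      atTop (𝓝 0) := by
  suffices h : Tendsto
      (fun C => ∫ u in Ioi (0 : ℝ), |gammaApprox ν C u - u ^ (ν - 1) * Real.exp (-u)|)
      atTop (𝓝 (∫ _ in Ioi (0 : ℝ), (0 : ℝ))) by simpa only [integral_zero] using h
  refine tendsto_integral_filter_of_dominated_convergence
    (fun u => 2 * (u ^ (ν - 1) * Real.exp (-(u / 2)))) ?_ ?_
    ((integrableOn_rpow_mul_exp_neg_half hν).const_mul 2) ?_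
  · refine Eventually.of_forall fun C => Measurable.aestronglyMeasurable ?_
    have := measurable_gammaApprox ν C
    fun_prop
  · filter_upwards [eventually_ge_atTop (2 * ν + 2)] with C hC
    refine (ae_restrict_iff' measurableSet_Ioi).2 (Eventually.of_forall fun u hu => ?_)
    have hu : 0 < u := hu
    have h1 := gammaApprox_le hν hC hu.le
    have h2 := gammaApprox_nonneg (ν := ν) (C := C) hu.le
    have h3 : u ^ (ν - 1) * Real.exp (-u) ≤ u ^ (ν - 1) * Real.exp (-(u / 2)) := by
      gcongr
      linarith
    have h4 : 0 ≤ u ^ (ν - 1) * Real.exp (-u) := by positivity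
    rw [Real.norm_eq_abs, abs_abs, abs_le]
    constructor <;> linarith
  · refine Eventually.of_forall fun u => ?_
    have := (tendsto_gammaApprox ν u).sub_const (u ^ (ν - 1) * Real.exp (-u))
    simpa using this.abs

theorem measurable_truncatedPower (B : ℝ) : Measurable (truncatedPower B) := by
  unfold truncatedPower
  fun_prop

theorem truncatedPower_le_one {B s : ℝ} (hB : 1 ≤ B) (hs : 0 ≤ s) : truncatedPower B s ≤ 1 :=
  Real.rpow_le_one (le_max_right _ _) (max_le (by linarith) zero_le_one) (by linarith)

/-! ### Perturbation of averages and conclusion. -/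

/-- Perturbation bound for weighted averages: replacing the weight `f` by `g` and the averaged
function `φ` by `ψ`. -/
theorem abs_average_sub_average_le {X : Type*} [MeasurableSpace X] {μ : Measure X}
    {f g φ ψ : X → ℝ} {ε : ℝ} (hf : Integrable f μ) (hg : Integrable g μ)
    (hf0 : ∀ᵐ x ∂μ, 0 ≤ f x) (hg0 : ∀ᵐ x ∂μ, 0 ≤ g x)
    (hφ : AEStronglyMeasurable φ μ) (hψ : AEStronglyMeasurable ψ μ)
    (hφ0 : ∀ᵐ x ∂μ, 0 ≤ φ x) (hφ1 : ∀ᵐ x ∂μ, φ x ≤ 1)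
    (hφψ : ∀ᵐ x ∂μ, |φ x - ψ x| ≤ ε) (hfpos : 0 < ∫ x, f x ∂μ) (hgpos : 0 < ∫ x, g x ∂μ) :
    |(∫ x, f x * φ x ∂μ) / (∫ x, f x ∂μ) - (∫ x, g x * ψ x ∂μ) / ∫ x, g x ∂μ| ≤
      2 * (∫ x, |f x - g x| ∂μ) / (∫ x, g x ∂μ) + ε := by
  have hfφ : Integrable (fun x => f x * φ x) μ := by
    refine hf.mul_bdd (c := 1) hφ ?_
    filter_upwards [hφ0, hφ1] with x h0 h1
    rwa [Real.norm_of_nonneg h0]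
  have hgψ : Integrable (fun x => g x * ψ x) μ := by
    refine hg.mul_bdd (c := 1 + ε) hψ ?_
    filter_upwards [hφ0, hφ1, hφψ] with x h0 h1 h2
    rw [Real.norm_eq_abs, abs_le]
    rw [abs_le] at h2
    constructor <;> linarith
  have hD : Integrable (fun x => |f x - g x|) μ := (hf.sub hg).abs
  set N := ∫ x, f x ∂μ
  set M := ∫ x, g x ∂μ
  set P := ∫ x, f x * φ x ∂μ
  set Q := ∫ x, g x * ψ x ∂μ
  set D := ∫ x, |f x - g x| ∂μ
  have hP0 : 0 ≤ P := integral_nonneg_of_ae (by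
    filter_upwards [hf0, hφ0] with x h0 h1 using mul_nonneg h0 h1)
  have hPN : P ≤ N := integral_mono_ae hfφ hf (by
    filter_upwards [hf0, hφ1] with x h0 h1 using mul_le_of_le_one_right h0 h1)
  have hMN : |M - N| ≤ D := by
    rw [abs_sub_comm, ← integral_sub hf hg]
    exact abs_integral_le_integral_abs
  have hPQ : |P - Q| ≤ D + M * ε := by
    rw [← integral_sub hfφ hgψ, ← integral_mul_const, ← integral_add hD (hg.mul_const ε)]
    refine abs_integral_le_integral_abs.trans
      (integral_mono_ae (hfφ.sub hgψ).abs (hD.add (hg.mul_const ε)) ?_)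
    filter_upwards [hφ0, hφ1, hφψ, hg0] with x h0 h1 h2 h3
    calc |f x * φ x - g x * ψ x| = |(f x - g x) * φ x + g x * (φ x - ψ x)| := by ring_nf
      _ ≤ |f x - g x| * φ x + g x * |φ x - ψ x| := by
          refine (abs_add_le _ _).trans ?_
          rw [abs_mul, abs_mul, abs_of_nonneg h0, abs_of_nonneg h3]
      _ ≤ |f x - g x| + g x * ε := by
          refine add_le_add (mul_le_of_le_one_right (abs_nonneg _) h1) ?_
          exact mul_le_mul_of_nonneg_left h2 h3
  -- As `P / N ≤ 1`, no lower bound on `N` is needed: only the mass `M` of the limiting weight stays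
  -- in the denominator.
  have hsplit : P / N - Q / M = (P / N * (M - N) + (P - Q)) / M := by
    field_simp
    ring
  rw [hsplit, abs_div, abs_of_pos hgpos, div_le_iff₀ hgpos, add_mul, div_mul_cancel₀ _ hgpos.ne']
  have hPN1 : P / N ≤ 1 := (div_le_one hfpos).2 hPN
  have : |P / N * (M - N)| ≤ D := by
    rw [abs_mul, abs_of_nonneg (by positivity)]
    exact (mul_le_of_le_one_left (abs_nonneg _) hPN1).trans hMN
  linarith [abs_add_le (P / N * (M - N)) (P - Q)]

/-- Quantitative form of the convergence, uniform in `h`. -/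
theorem abs_gaussHypergeometricCov_sub_maternCov_le {d : ℕ} {a α β γ b : ℝ}
    (hα : (d : ℝ) / 2 < α) (hb : 0 < b) (ha : 0 < a) (hβ : 2 ≤ β - d / 2) (hβα : α < β)
    (hγ : 2 * (α - d / 2) + 2 ≤ γ - d / 2) {θ : ℝ}
    (hθ : θ = (β - d / 2 - 1) * (γ - d / 2) * (4 * b ^ 2) / a ^ 2)
    (h : EuclideanSpace ℝ (Fin d)) :
    |gaussHypergeometricCov d a α β γ h - maternCov d b (α - d / 2) h| ≤
      2 * (∫ u in Ioi (0 : ℝ), |gammaApprox (α - d / 2) (γ - d / 2) u -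
        u ^ (α - d / 2 - 1) * Real.exp (-u)|) / Real.Gamma (α - d / 2) +
        (2 / (β - d / 2 - 1) + (|θ - 1| + |θ⁻¹ - 1|)) := by
  have hν : 0 < α - d / 2 := by linarith
  have hmix := gaussHypergeometricCov_mul_integral_gammaApprox (a := a) hα (by linarith) hβα
    (by linarith : α - d / 2 + 1 < γ - d / 2) h
  have hmat := maternCov_eq_integral (d := d) hb hν h
  set ν := α - d / 2
  set B := β - d / 2
  set C := γ - d / 2
  have hC0 : 0 < C := by linarith
  have hN : 0 < ∫ u in Ioi (0 : ℝ), gammaApprox ν C u := by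
    rw [integral_gammaApprox hν (by linarith)]
    have := Real.Gamma_pos_of_pos hν
    have := Real.Gamma_pos_of_pos hC0
    have : 0 < Real.Gamma (C - ν) := Real.Gamma_pos_of_pos (by linarith)
    positivity
  have hΓ := setIntegral_rpow_mul_exp_neg hν
  rw [eq_div_of_mul_eq hN.ne' hmix, hmat, ← hΓ]
  refine abs_average_sub_average_le (integrableOn_gammaApprox hν hγ)
    (integrableOn_rpow_mul_exp_neg hν) ?_ ?_ ?_ ?_ ?_ ?_ ?_ hN
    (hΓ ▸ Real.Gamma_pos_of_pos hν)
  · refine (ae_restrict_iff' measurableSet_Ioi).2 (Eventually.of_forall fun u hu => ?_)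
    exact gammaApprox_nonneg (le_of_lt hu)
  · refine (ae_restrict_iff' measurableSet_Ioi).2 (Eventually.of_forall fun u hu => ?_)
    have hu : 0 < u := hu
    positivity
  · refine Measurable.aestronglyMeasurable ((measurable_truncatedPower B).comp ?_)
    fun_prop
  · exact Measurable.aestronglyMeasurable (by fun_prop)
  · exact Eventually.of_forall fun u => truncatedPower_nonneg _ _
  · refine (ae_restrict_iff' measurableSet_Ioi).2 (Eventually.of_forall fun u hu => ?_)
    have hu : 0 < u := hu
    exact truncatedPower_le_one (by linarith) (by positivity)
  · refine (ae_restrict_iff' measurableSet_Ioi).2 (Eventually.of_forall fun u hu => ?_)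
    have hu : 0 < u := hu
    have hB1 : 0 < B - 1 := by linarith
    have hθ0 : 0 < θ := by rw [hθ]; positivity
    have h1 := abs_truncatedPower_sub_exp_neg_le hβ
      (s := C * (‖h‖ ^ 2 / a ^ 2) / u) (by positivity)
    have h2 := abs_exp_neg_mul_sub_exp_neg_le hθ0
      (q := ‖h‖ ^ 2 / (4 * b ^ 2) / u) (by positivity)
    -- `θ` is the ratio of the two exponents, free of `h` and `u`.
    have e : (B - 1) * (C * (‖h‖ ^ 2 / a ^ 2) / u) = θ * (‖h‖ ^ 2 / (4 * b ^ 2) / u) := by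
      rw [hθ]
      field_simp
    rw [e] at h1
    exact (abs_sub_le _ _ _).trans (add_le_add h1 h2)

/-- The expression factors as `(1 - (r + 1)/β) * (1 - r/γ) * (4b²βγ/a²)`, each factor tending to
`1`. -/
theorem tendsto_scale_ratio {ι : Type*} {l : Filter ι} {a β γ : ι → ℝ} {b : ℝ} (hb : 0 < b) (r : ℝ)
    (hβ : Tendsto β l atTop) (hγ : Tendsto γ l atTop)
    (hab : Tendsto (fun i => a i / (2 * Real.sqrt (β i * γ i))) l (𝓝 b)) :
    Tendsto (fun i => (β i - r - 1) * (γ i - r) * (4 * b ^ 2) / a i ^ 2) l (𝓝 1) := by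
  have h1 : Tendsto (fun i => 1 - (r + 1) / β i) l (𝓝 1) := by
    simpa using ((tendsto_const_nhds (x := r + 1)).div_atTop hβ).const_sub 1
  have h2 : Tendsto (fun i => 1 - r / γ i) l (𝓝 1) := by
    simpa using ((tendsto_const_nhds (x := r)).div_atTop hγ).const_sub 1
  have h3 : Tendsto (fun i => b ^ 2 / (a i / (2 * Real.sqrt (β i * γ i))) ^ 2) l (𝓝 1) := by
    have := (tendsto_const_nhds (x := b ^ 2)).div (hab.pow 2) (by positivity)
    rwa [div_self (by positivity)] at this
  have h4 := (h1.mul h2).mul h3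
  rw [one_mul, one_mul] at h4
  refine h4.congr' ?_
  filter_upwards [hβ.eventually_gt_atTop 0, hγ.eventually_gt_atTop 0] with i hβi hγi
  rw [div_pow, mul_pow, Real.sq_sqrt (by positivity)]
  field_simp
  ring

theorem theorem11 (d : ℕ) (hd : 1 ≤ d) (α : ℝ) (hα : (d : ℝ) / 2 < α) (b : ℝ) (hb : 0 < b)
    {ι : Type*} (l : Filter ι) (a β γ : ι → ℝ)
    (ha : Filter.Tendsto a l Filter.atTop)
    (hβ : Filter.Tendsto β l Filter.atTop)
    (hγ : Filter.Tendsto γ l Filter.atTop)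
    (hab : Filter.Tendsto (fun i => a i / (2 * Real.sqrt (β i * γ i))) l (nhds b)) :
    TendstoUniformly (fun i => gaussHypergeometricCov d (a i) α (β i) (γ i))
      (maternCov d b (α - d / 2)) l := by
  have hν : 0 < α - d / 2 := by linarith
  have hθ := tendsto_scale_ratio hb ((d : ℝ) / 2) hβ hγ hab
  have hγ' : Tendsto (fun i => γ i - d / 2) l atTop := by
    simpa only [sub_eq_add_neg] using tendsto_atTop_add_const_right l (-((d : ℝ) / 2)) hγ
  have hβ' : Tendsto (fun i => β i - d / 2 - 1) l atTop := by
    simpa only [sub_eq_add_neg, add_assoc] using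
      tendsto_atTop_add_const_right l (-((d : ℝ) / 2) + -1) hβ
  have hD := ((tendsto_integral_abs_gammaApprox_sub hν).comp hγ').const_mul 2 |>.div_const
    (Real.Gamma (α - d / 2))
  have hθ1 := (hθ.sub_const 1).abs
  have hθ2 := ((hθ.inv₀ one_ne_zero).sub_const 1).abs
  -- The total error bound tends to `0` and does not involve `h`.
  have hbound := hD.add (((tendsto_const_nhds (x := (2 : ℝ))).div_atTop hβ').add (hθ1.add hθ2))
  simp only [mul_zero, zero_div, inv_one, sub_self, abs_zero, add_zero] at hbound
  rw [Metric.tendstoUniformly_iff]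
  intro ε hε
  filter_upwards [hbound.eventually_lt_const hε, ha.eventually_gt_atTop 0,
    hβ'.eventually_ge_atTop 1, hβ.eventually_gt_atTop α,
    hγ'.eventually_ge_atTop (2 * (α - d / 2) + 2)] with i hi hai hβi hβαi hγi h
  rw [dist_comm, Real.dist_eq]
  exact (abs_gaussHypergeometricCov_sub_maternCov_le hα hb hai (by linarith) hβαi hγi rfl h).trans_lt
    hi

end
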